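/- A \emph{Clifford circuit} $\mathcal C$ on $n$ qubits is a finite chronological sequence of operations, each of which is either a Clifford unitary acting on a given set of qubits (its support) or the measurement of a signed Pauli operator $\pm P$ (its support is that of $P$). Each operation is placed at an integer level $\ge 1$, and distinct operations at the same level have disjoint supports. Let $\Delta$ be the maximum level (the depth), let $S_1,\dots,S_m$ be the measured operators, with levels $\ell_1,\dots,\ell_m$, and let $\mathcal O(\mathcal C)\subseteq\mathbb Z_2^m$ be the set of outcome bit-strings that occur with nonzero probability for some input state. Assume, as a standing convention, that $\mathcal O(\mathcal C)$ is a linear subspace. A \emph{fault operator} is a Pauli operator $F$, up to phase, on the $n(\Delta+1)$ qubits $(\ell+0.5,q)$ with $0\le\ell\le\Delta$, $1\le q\le n$; its component at time $\ell+0.5$ is denoted $F_{\ell+0.5}$. Let $U_\ell$ be the product of the unitary operations at level $\ell$. The \emph{back-cumulant} $\overleftarrow F$ of $F$ is defined by $\overleftarrow F_{\Delta+0.5}=F_{\Delta+0.5}$ and $\overleftarrow F_{\ell-0.5}=F_{\ell-0.5}\cdot U_\ell^{-1}\,\overleftarrow F_{\ell+0.5}\,U_\ell$ for $\ell=\Delta,\dots,1$.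 For $u\in\mathbb Z_2^m$ let $F(u)$ be the product, over all $j$ with $u_j=1$, of $S_j$ placed at time $\ell_j-0.5$. The \emph{stabilizers of the spacetime code} of $\mathcal C$ are the operators $\overleftarrow{F(u)}$ with $u\in\mathcal O(\mathcal C)^\perp$ (up to phase). The \emph{spacetime graph} has vertices $(\ell+0.5,q)$ with $0\le\ell\le\Delta-1$, $1\le q\le n$. For each operation of level $\ell$ acting on a set $A$ of qubits, all vertices $(\ell\pm0.5,q)$ with $q\in A$ are joined pairwise; a qubit that is idle at some level in $\{1,\dots,\Delta\}$ is regarded as undergoing the one-qubit identity operation at that level. A connected component of the support of an operator means a connected component of the subgraph induced by its support, and a stabilizer is \emph{connected} if its support lies in the vertex set and induces a nonempty connected subgraph. The restriction $S_{|\kappa}$ is obtained from $S$ by replacing all components outside $\kappa$ by the identity. \textbf{Proposition.} Let $S$ be a stabilizer of the spacetime code of $\mathcal C$. For every connected component $\kappa$ of the support of $S$ in the spacetime graph, the restriction $S_{|\kappa}$ is a stabilizer of the spacetime code. Hence $S$ is a product of connected stabilizers with pairwise disjoint supports: the operators $S_{|\kappa}$, for $\kappa$ running over the connected components of the support of $S$,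 are connected stabilizers, have pairwise disjoint supports, and their product is $S$ (up to phase; the empty product if $S$ is trivial). -/

import Mathlib

open scoped Matrix ComplexOrder

noncomputable section

namespace SpacetimeCode

/-- `n`-qubit Pauli operators up to phase. The component `(x, z)` on a qubit stands for `I`, `X`, `Z`
or `Y` according to `(x, z) = (0, 0), (1, 0), (0, 1), (1, 1)`. The product of Pauli operators up to
phase is the (pointwise) addition. -/
abbrev PauliOp (n : ℕ) : Type := Fin n → ZMod 2 × ZMod 2

/-- Operators on `n` qubits, as matrices in the computational basis. -/
abbrev QMatrix (n : ℕ) : Type := Matrix (Fin n → Fin 2) (Fin n → Fin 2) ℂ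

/-- The four one-qubit Pauli matrices `I`, `X`, `Z`, `Y`. -/
def singlePauli (p : ZMod 2 × ZMod 2) : Matrix (Fin 2) (Fin 2) ℂ :=
  if p = (0, 0) then 1
  else if p = (1, 0) then !![0, 1; 1, 0]
  else if p = (0, 1) then !![1, 0; 0, -1]
  else !![0, -Complex.I; Complex.I, 0]

/-- The Hermitian matrix (a tensor product of `I`, `X`, `Y`, `Z`) representing a Pauli operator. -/
def pauliMatrix {n : ℕ} (P : PauliOp n) : QMatrix n :=
  fun a b => ∏ q, singlePauli (P q) (a q) (b q)

/-- The set of qubits on which a Pauli operator is not the identity. -/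
def pauliSupport {n : ℕ} (P : PauliOp n) : Finset (Fin n) :=
  Finset.univ.filter (fun q => P q ≠ 0)

/-- `P` is mapped to `Q`, up to phase, under conjugation by `U`. -/
def ConjugatesTo {n : ℕ} (U : QMatrix n) (P Q : PauliOp n) : Prop :=
  ∃ c : ℂ, c ≠ 0 ∧ U * pauliMatrix P * U⁻¹ = c • pauliMatrix Q

/-- Clifford unitaries: unitaries that conjugate Pauli operators to Pauli operators up to phase. -/
def IsClifford {n : ℕ} (U : QMatrix n) : Prop :=
  U ∈ Matrix.unitaryGroup (Fin n → Fin 2) ℂ ∧ ∀ P, ∃ Q, ConjugatesTo U P Q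

open Classical in
/-- The Pauli operator `U P U⁻¹` up to phase, for a Clifford unitary `U` (and `I` if `U P U⁻¹` is not
proportional to a Pauli operator). -/
def conjugate {n : ℕ} (U : QMatrix n) (P : PauliOp n) : PauliOp n :=
  if h : ∃ Q, ConjugatesTo U P Q then h.choose else 0

/-- `U` is of the form `V ⊗ I` with `V` acting on the qubits in `A`. -/
def ActsOn {n : ℕ} (U : QMatrix n) (A : Finset (Fin n)) : Prop :=
  ∃ V : Matrix (A → Fin 2) (A → Fin 2) ℂ, ∀ a b : Fin n → Fin 2,
    ((∀ q, q ∉ A → a q = b q) → U a b = V (fun q => a q) (fun q => b q)) ∧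
    ((∃ q, q ∉ A ∧ a q ≠ b q) → U a b = 0)

/-- A Clifford operation: either a Clifford unitary acting on a set `A` of qubits, or the measurement
of the signed Pauli operator `(-1) ^ sign P`. -/
inductive CliffordOp (n : ℕ) : Type
  | gate (A : Finset (Fin n)) (U : QMatrix n) (hU : IsClifford U) (hA : ActsOn U A) : CliffordOp n
  | meas (sign : ZMod 2) (P : PauliOp n) : CliffordOp n

namespace CliffordOp

variable {n : ℕ}

/-- The set of qubits on which an operation acts. -/
def support : CliffordOp n → Finset (Fin n)
  | gate A _ _ _ => A
  | meas _ P => pauliSupport P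

def isMeasurement : CliffordOp n → Bool
  | gate _ _ _ _ => false
  | meas _ _ => true

/-- The unitary of a unitary operation, and the identity for a measurement. -/
def unitary : CliffordOp n → QMatrix n
  | gate _ U _ _ => U
  | meas _ _ => 1

/-- The measured operator, up to phase (only used for measurements). -/
def measured : CliffordOp n → PauliOp n
  | gate _ _ _ _ => 0
  | meas _ P => P

/-- The linear map applied to the state: `U` for a unitary operation `U`, and the projector
`(I + (-1) ^ o M) / 2` for the measurement of `M` with outcome `o`. -/
def kraus (o : ZMod 2) : CliffordOp n → QMatrix n
  | gate _ U _ _ => U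
  | meas sign P => (1 / 2 : ℂ) • (1 + (-1 : ℂ) ^ o.val • ((-1 : ℂ) ^ sign.val • pauliMatrix P))

end CliffordOp

/-- A Clifford circuit on `n` qubits: a chronological sequence of Clifford operations placed at levels
`1, 2, …` such that distinct operations at the same level have disjoint supports. -/
structure CliffordCircuit (n : ℕ) where
  size : ℕ
  op : Fin size → CliffordOp n
  level : Fin size → ℕ
  one_le_level : ∀ i, 1 ≤ level i
  chronological : Monotone level
  disjoint_support : ∀ i j, i ≠ j → level i = level j → Disjoint (op i).support (op j).support

namespace CliffordCircuit

variable {n : ℕ} (C : CliffordCircuit n)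

/-- The maximum level of the operations (`0` for the empty circuit). -/
def depth : ℕ := Finset.univ.sup C.level

/-- The indices of the measurements of the circuit. -/
abbrev Meas : Type := {i : Fin C.size // (C.op i).isMeasurement = true}

/-- Outcome bit-strings. -/
abbrev Outcome : Type := C.Meas → ZMod 2

/-- The linear map applied to the state by the `i`-th operation when the outcome is `o`. -/
def krausAt (o : C.Outcome) (i : Fin C.size) : QMatrix n :=
  (C.op i).kraus (if h : (C.op i).isMeasurement = true then o ⟨i, h⟩ else 0)

/-- The linear map applied to the input state by the whole (noiseless) circuit when the outcome
is `o`; the first operation is the rightmost factor. -/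
def krausProd (o : C.Outcome) : QMatrix n :=
  ((List.finRange C.size).reverse.map (C.krausAt o)).prod

/-- The probability of the outcome `o` for the input state `ρ`. -/
def outcomeProb (ρ : QMatrix n) (o : C.Outcome) : ℝ :=
  (Matrix.trace (C.krausProd o * ρ * (C.krausProd o)ᴴ)).re

/-- The set of outcome bit-strings that are possible for some input density matrix. -/
def outcomeCode : Set C.Outcome :=
  {o | ∃ ρ : QMatrix n, ρ.PosSemidef ∧ ρ.trace = 1 ∧ 0 < C.outcomeProb ρ o}

/-- The standing convention that the outcome code is a linear subspace. -/
def HasLinearOutcomeCode : Prop :=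
  ∃ W : Submodule (ZMod 2) C.Outcome, (W : Set C.Outcome) = C.outcomeCode

/-- The checks of the outcome code, that is the vectors orthogonal to it. -/
def checks : Set C.Outcome := {u | ∀ o ∈ C.outcomeCode, u ⬝ᵥ o = 0}

/-- Fault operators up to phase. The index `ℓ = 0, …, Δ` stands for the half-integer time `ℓ + 0.5`. -/
abbrev Fault : Type := Fin (C.depth + 1) → PauliOp n

/-- The product of the unitary operations at level `ℓ`. -/
def levelUnitary (ℓ : ℕ) : QMatrix n :=
  ((List.finRange C.size).reverse.map
    (fun i => if C.level i = ℓ then (C.op i).unitary else 1)).prod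

/-- The back-cumulant `G` of a fault operator `F`: at the last time it equals `F`, and going backward
through level `ℓ + 1`, from time `(ℓ + 1) + 0.5` to time `ℓ + 0.5`, one multiplies `F` by the
conjugate of the later component of `G` by the inverse of the unitary of that level. -/
def backCumulant (F : C.Fault) : C.Fault := fun k =>
  Fin.reverseInduction (motive := fun _ => PauliOp n) (F (Fin.last C.depth))
    (fun ℓ G => F ℓ.castSucc + conjugate (C.levelUnitary (ℓ + 1))⁻¹ G) k

/-- The fault operator `F(u)` obtained by placing each measured operator with `u j = 1` right before
its measurement, that is at time `level j - 0.5`. -/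
def measFault (u : C.Outcome) : C.Fault := fun k =>
  ∑ j : C.Meas, if (k : ℕ) + 1 = C.level j.1 then u j • (C.op j.1).measured else 0

/-- The stabilizers (up to phase) of the spacetime code: the check operators, which are the
back-cumulants of `F(u)` for the checks `u` of the outcome code. -/
def IsStabilizer (S : C.Fault) : Prop := ∃ u ∈ C.checks, S = C.backCumulant (C.measFault u)

/-- The qubit `q` is idle at level `ℓ`. -/
def IsIdle (ℓ : ℕ) (q : Fin n) : Prop :=
  1 ≤ ℓ ∧ ℓ ≤ C.depth ∧ ∀ i, C.level i = ℓ → q ∉ (C.op i).support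

/-- The sets of qubits that are processed together at level `ℓ`: supports of the operations of that
level, and single idle qubits (which undergo the identity operation). -/
def IsBlock (ℓ : ℕ) (A : Finset (Fin n)) : Prop :=
  (∃ i, C.level i = ℓ ∧ (C.op i).support = A) ∨ (∃ q, C.IsIdle ℓ q ∧ A = {q})

/-- The vertices of the spacetime graph; `(ℓ, q)` is the qubit `q` at time `ℓ + 0.5`, and the last
time `Δ + 0.5` is left out. -/
abbrev Vertex : Type := Fin C.depth × Fin n

/-- The vertex lies right before or right after level `ℓ`, on a qubit of `A`. -/
def Touches (ℓ : ℕ) (A : Finset (Fin n)) (v : C.Vertex) : Prop :=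
  ((v.1 : ℕ) + 1 = ℓ ∨ (v.1 : ℕ) = ℓ) ∧ v.2 ∈ A

/-- The spacetime graph: each operation (including the identity on each idle qubit) induces a clique
on the qubits on which it acts, taken right before and right after it. -/
def spacetimeGraph : SimpleGraph C.Vertex where
  Adj v w := v ≠ w ∧ ∃ ℓ A, C.IsBlock ℓ A ∧ C.Touches ℓ A v ∧ C.Touches ℓ A w
  symm := ⟨fun _ _ h => ⟨h.1.symm, h.2.imp fun _ h' => h'.imp fun _ h'' => ⟨h''.1, h''.2.2, h''.2.1⟩⟩⟩
  loopless := ⟨fun _ h => h.1 rfl⟩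

/-- The full support of a fault operator. -/
def faultSupport (F : C.Fault) : Set (Fin (C.depth + 1) × Fin n) := {p | F p.1 p.2 ≠ 0}

/-- The support of a fault operator, as a set of vertices of the spacetime graph. -/
def vertexSupport (F : C.Fault) : Set C.Vertex := {v | F v.1.castSucc v.2 ≠ 0}

/-- `κ` is (the vertex set of) a connected component of the support of `F` in the spacetime graph. -/
def IsSupportComponent (F : C.Fault) (κ : Set C.Vertex) : Prop :=
  ∃ c : (C.spacetimeGraph.induce (C.vertexSupport F)).ConnectedComponent,
    κ = Subtype.val '' c.supp

open Classical in
/-- The restriction of `F` to `κ`: all components outside `κ` are replaced by the identity. -/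
def restrict (F : C.Fault) (κ : Set C.Vertex) : C.Fault := fun k q =>
  if ∃ v ∈ κ, v.1.castSucc = k ∧ v.2 = q then F k q else 0

/-- Connected stabilizers: stabilizers whose support is contained in the vertex set of the spacetime
graph and induces a connected (in particular nonempty) subgraph. -/
def IsConnectedStabilizer (S : C.Fault) : Prop :=
  C.IsStabilizer S ∧ S (Fin.last C.depth) = 0 ∧
    (C.spacetimeGraph.induce (C.vertexSupport S)).Connected

end CliffordCircuit

end SpacetimeCode

end

noncomputable section

namespace SpacetimeCode

/-! Membership in the dual of the outcome code is turned into a local condition on the back-cumulant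
`G` of `F(u)`: `u` is a check iff, at every measurement, the component of `G` right after it
commutes with the measured operator, and `G` is trivial at the initial time
(`IsConsistent.mem_checks_iff`).

For this criterion, let `K_f` be the linear map of the circuit for outcomes `f`, and consider the
signed sum of `(-1)^(u·f) K_f† K_f`. Evaluated backward from the identity, it is a multiple of the
Pauli operator `G 0` if no anticommutation is met, and vanishes otherwise. For a check all signs on
nonzero terms are `1`, so the sum is a nonzero multiple of the identity, which forces both
conditions. Conversely, the conditions give `K_f = c (-1)^(u·f) K_f` with `c` independent of `f`;
since `0` is a possible outcome, `c = 1`, and `u` is orthogonal to every possible outcome.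

The recursion defining `G` is local as well: it relates only the values just before and just after
one operation, on its support (`IsConsistent`). These vertices form a clique, so a component of the
support contains all or none of the support vertices among them. Restricting `G` to a component, and
`u` to the measurements touching it, therefore preserves the recursion and the criterion
(`IsConsistent.restrict`, `IsStabilizer.restrict`). -/

/-! ### Signs and one-qubit Pauli matrices. -/

/-- The sign `(-1) ^ a`. -/
def sgn (a : ZMod 2) : ℂ := (-1) ^ a.val

lemma sgn_zero : sgn 0 = 1 := by simp [sgn]

lemma sgn_one : sgn 1 = -1 := by simp [sgn, ZMod.val_one]

lemma zmod_two_cases (a : ZMod 2) : a = 0 ∨ a = 1 := by revert a; decide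

lemma sgn_add (a b : ZMod 2) : sgn (a + b) = sgn a * sgn b := by
  have h : (1 + 1 : ZMod 2) = 0 := by decide
  rcases zmod_two_cases a with rfl | rfl <;> rcases zmod_two_cases b with rfl | rfl <;>
    simp [sgn_zero, sgn_one, h]

lemma sgn_mul_self (a : ZMod 2) : sgn a * sgn a = 1 := by
  rcases zmod_two_cases a with rfl | rfl <;> simp [sgn_zero, sgn_one]

lemma sgn_ne_zero (a : ZMod 2) : sgn a ≠ 0 := by
  rcases zmod_two_cases a with rfl | rfl <;> simp [sgn_zero, sgn_one]

lemma sgn_eq_one {a : ZMod 2} (h : sgn a = 1) : a = 0 := by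
  rcases zmod_two_cases a with rfl | rfl
  · rfl
  · rw [sgn_one] at h; norm_num at h

lemma sgn_injective : Function.Injective sgn := by
  intro a b h
  have h2 : sgn (a + b) = 1 := by rw [sgn_add, h, sgn_mul_self]
  exact (CharTwo.add_eq_zero).1 (sgn_eq_one h2)

lemma sgn_sum {ι : Type*} (s : Finset ι) (f : ι → ZMod 2) :
    sgn (∑ i ∈ s, f i) = ∏ i ∈ s, sgn (f i) := by
  classical
  induction s using Finset.induction_on with
  | empty => simp [sgn_zero]
  | insert a s ha ih => rw [Finset.sum_insert ha, Finset.prod_insert ha, sgn_add, ih]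

lemma star_sgn (a : ZMod 2) : star (sgn a) = sgn a := by
  rcases zmod_two_cases a with rfl | rfl <;> simp [sgn_zero, sgn_one]

/-- The symplectic form on one qubit. -/
def singleSymp (p q : ZMod 2 × ZMod 2) : ZMod 2 := p.1 * q.2 + p.2 * q.1

lemma single_cases (p : ZMod 2 × ZMod 2) :
    p = (0, 0) ∨ p = (1, 0) ∨ p = (0, 1) ∨ p = (1, 1) := by
  revert p; decide

lemma singlePauli_zero : singlePauli (0, 0) = 1 := by simp [singlePauli]

lemma singlePauli_x : singlePauli (1, 0) = !![0, 1; 1, 0] := by simp [singlePauli]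

lemma singlePauli_z : singlePauli (0, 1) = !![1, 0; 0, -1] := by simp [singlePauli]

lemma singlePauli_y : singlePauli (1, 1) = !![0, -Complex.I; Complex.I, 0] := by
  simp [singlePauli]

lemma singlePauli_mul (p q : ZMod 2 × ZMod 2) :
    ∃ c : ℂ, c ≠ 0 ∧ singlePauli p * singlePauli q = c • singlePauli (p + q) := by
  have h : (1 + 1 : ZMod 2) = 0 := by decide
  have hI : (-Complex.I) ≠ 0 := neg_ne_zero.2 Complex.I_ne_zero
  rcases single_cases p with rfl | rfl | rfl | rfl <;>
    rcases single_cases q with rfl | rfl | rfl | rfl <;>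
    simp only [Prod.mk_add_mk, add_zero, zero_add, h, singlePauli_zero, singlePauli_x,
      singlePauli_y, singlePauli_z]
  -- The sixteen products produce only the phases `1`, `i` and `-i`.
  any_goals refine ⟨1, one_ne_zero, ?_⟩; simp [Matrix.one_fin_two]; done
  any_goals refine ⟨Complex.I, Complex.I_ne_zero, ?_⟩; simp; done
  any_goals refine ⟨-Complex.I, hI, ?_⟩; simp

lemma singlePauli_comm (p q : ZMod 2 × ZMod 2) :
    singlePauli p * singlePauli q = sgn (singleSymp p q) • (singlePauli q * singlePauli p) := by
  have h : (1 + 1 : ZMod 2) = 0 := by decide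
  rcases single_cases p with rfl | rfl | rfl | rfl <;>
    rcases single_cases q with rfl | rfl | rfl | rfl <;>
    simp [singlePauli_zero, singlePauli_x, singlePauli_y, singlePauli_z, singleSymp, sgn_zero,
      sgn_one, h]

lemma singlePauli_mul_self (p : ZMod 2 × ZMod 2) : singlePauli p * singlePauli p = 1 := by
  rcases single_cases p with rfl | rfl | rfl | rfl <;>
    simp [singlePauli_zero, singlePauli_x, singlePauli_y, singlePauli_z, Matrix.one_fin_two]

lemma singlePauli_star (p : ZMod 2 × ZMod 2) (a b : Fin 2) :
    star (singlePauli p b a) = singlePauli p a b := by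
  rcases single_cases p with rfl | rfl | rfl | rfl <;> fin_cases a <;> fin_cases b <;>
    simp [singlePauli_zero, singlePauli_x, singlePauli_y, singlePauli_z]

/-! ### Pauli operators on `n` qubits and the symplectic form. -/

variable {n : ℕ}

/-- The symplectic form: `0` if the two operators commute, and `1` if they anticommute. -/
def symp (P Q : PauliOp n) : ZMod 2 := ∑ q, singleSymp (P q) (Q q)

lemma symp_zero_left (Q : PauliOp n) : symp 0 Q = 0 := by simp [symp, singleSymp]

lemma symp_single_right (P : PauliOp n) (q : Fin n) (r : ZMod 2 × ZMod 2) :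
    symp P (Pi.single q r) = singleSymp (P q) r := by
  rw [symp, Finset.sum_eq_single q]
  · simp
  · intro b _ hb
    simp [Pi.single_eq_of_ne hb, singleSymp]
  · simp

lemma eq_of_singleSymp_eq {p p' : ZMod 2 × ZMod 2}
    (h : ∀ r, singleSymp p r = singleSymp p' r) : p = p' := by
  have h1 := h (1, 0)
  have h2 := h (0, 1)
  simp only [singleSymp, mul_zero, mul_one, zero_add, add_zero] at h1 h2
  exact Prod.ext h2 h1

/-- A Pauli operator up to phase is determined by its commutation relations. -/
lemma eq_of_symp_eq {P P' : PauliOp n} (h : ∀ R, symp P R = symp P' R) : P = P' :=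
  funext fun q => eq_of_singleSymp_eq fun r => by
    simpa [symp_single_right] using h (Pi.single q r)

lemma tensor_mul_apply (s t : Fin n → Matrix (Fin 2) (Fin 2) ℂ) (a b : Fin n → Fin 2) :
    ∑ c : Fin n → Fin 2, (∏ q, s q (a q) (c q)) * ∏ q, t q (c q) (b q) =
      ∏ q, (s q * t q) (a q) (b q) := by
  simp only [Matrix.mul_apply, Finset.prod_univ_sum, Fintype.piFinset_univ,
    Finset.prod_mul_distrib]

lemma pauliMatrix_mul_apply (P Q : PauliOp n) (a b : Fin n → Fin 2) :
    (pauliMatrix P * pauliMatrix Q) a b =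
      ∏ q, (singlePauli (P q) * singlePauli (Q q)) (a q) (b q) := by
  rw [Matrix.mul_apply, ← tensor_mul_apply]
  rfl

lemma prod_one_apply (a b : Fin n → Fin 2) :
    ∏ q, (1 : Matrix (Fin 2) (Fin 2) ℂ) (a q) (b q) = (1 : QMatrix n) a b := by
  by_cases h : a = b
  · subst h; simp
  · obtain ⟨q, hq⟩ := Function.ne_iff.1 h
    rw [Matrix.one_apply_ne h]
    exact Finset.prod_eq_zero (Finset.mem_univ q) (Matrix.one_apply_ne hq)

lemma pauliMatrix_zero : pauliMatrix (0 : PauliOp n) = 1 := by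
  ext a b
  rw [← prod_one_apply, ← singlePauli_zero]
  rfl

lemma pauliMatrix_mul_self (P : PauliOp n) : pauliMatrix P * pauliMatrix P = 1 := by
  ext a b
  simp only [pauliMatrix_mul_apply, singlePauli_mul_self, prod_one_apply]

lemma pauliMatrix_mul (P Q : PauliOp n) :
    ∃ c : ℂ, c ≠ 0 ∧ pauliMatrix P * pauliMatrix Q = c • pauliMatrix (P + Q) := by
  choose c hc h using fun q => singlePauli_mul (P q) (Q q)
  refine ⟨∏ q, c q, Finset.prod_ne_zero_iff.2 fun q _ => hc q, ?_⟩
  ext a b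
  simp only [pauliMatrix_mul_apply, h, Matrix.smul_apply, smul_eq_mul, Finset.prod_mul_distrib]
  rfl

lemma pauliMatrix_comm (P Q : PauliOp n) :
    pauliMatrix P * pauliMatrix Q = sgn (symp P Q) • (pauliMatrix Q * pauliMatrix P) := by
  ext a b
  simp only [Matrix.smul_apply, smul_eq_mul, symp, sgn_sum, pauliMatrix_mul_apply,
    ← Finset.prod_mul_distrib]
  refine Finset.prod_congr rfl fun q _ => ?_
  rw [singlePauli_comm (P q) (Q q)]
  rfl

lemma pauliMatrix_conjTranspose (P : PauliOp n) : (pauliMatrix P)ᴴ = pauliMatrix P := by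
  ext a b
  rw [Matrix.conjTranspose_apply]
  simp only [pauliMatrix, star_prod, singlePauli_star]

lemma pauliMatrix_mul_ne_zero (P Q : PauliOp n) : pauliMatrix P * pauliMatrix Q ≠ 0 := by
  intro h
  have : pauliMatrix P * (pauliMatrix P * pauliMatrix Q) * pauliMatrix Q = 1 := by
    rw [← mul_assoc, pauliMatrix_mul_self, one_mul, pauliMatrix_mul_self]
  rw [h] at this
  simp at this

/-- Products of Pauli matrices are nonzero, so the commutation sign is unique and can be read off a
matrix identity. -/
lemma symp_eq_of_smul_comm {P R : PauliOp n} {s : ZMod 2}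
    (h : pauliMatrix P * pauliMatrix R = sgn s • (pauliMatrix R * pauliMatrix P)) :
    symp P R = s := by
  rw [pauliMatrix_comm] at h
  exact sgn_injective (smul_left_injective ℂ (pauliMatrix_mul_ne_zero R P) h)

/-- Proportional matrices have the same commutation relations, and the symplectic form is
nondegenerate. -/
lemma eq_of_smul_pauliMatrix_eq {P Q : PauliOp n} {c d : ℂ} (hc : c ≠ 0)
    (h : c • pauliMatrix P = d • pauliMatrix Q) : P = Q := by
  refine eq_of_symp_eq fun R => symp_eq_of_smul_comm ?_
  have hP : pauliMatrix P = (c⁻¹ * d) • pauliMatrix Q := by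
    rw [← smul_smul, ← h, smul_smul, inv_mul_cancel₀ hc, one_smul]
  rw [hP, smul_mul_assoc, pauliMatrix_comm Q R, mul_smul_comm, smul_comm]

/-! ### Conjugation by Clifford unitaries, up to phase. -/

lemma ConjugatesTo.unique {U : QMatrix n} {P Q R : PauliOp n} (h : ConjugatesTo U P Q)
    (h' : ConjugatesTo U P R) : Q = R := by
  obtain ⟨c, hc, h⟩ := h
  obtain ⟨d, -, h'⟩ := h'
  exact eq_of_smul_pauliMatrix_eq hc (h.symm.trans h')

lemma ConjugatesTo.conjugate_eq {U : QMatrix n} {P Q : PauliOp n} (h : ConjugatesTo U P Q) :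
    conjugate U P = Q := by
  have h' : ∃ Q, ConjugatesTo U P Q := ⟨Q, h⟩
  rw [conjugate, dif_pos h']
  exact h'.choose_spec.unique h

lemma IsClifford.isUnit_det {U : QMatrix n} (hU : IsClifford U) : IsUnit U.det := by
  have h := Matrix.mem_unitaryGroup_iff.1 hU.1
  exact (Matrix.isUnit_iff_isUnit_det _).1 (IsUnit.of_mul_eq_one _ h)

lemma IsClifford.inv_mul {U : QMatrix n} (hU : IsClifford U) : U⁻¹ * U = 1 :=
  Matrix.nonsing_inv_mul U hU.isUnit_det

lemma IsClifford.mul_inv {U : QMatrix n} (hU : IsClifford U) : U * U⁻¹ = 1 :=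
  Matrix.mul_nonsing_inv U hU.isUnit_det

lemma IsClifford.inv_inv {U : QMatrix n} (hU : IsClifford U) : U⁻¹⁻¹ = U :=
  Matrix.nonsing_inv_nonsing_inv U hU.isUnit_det

lemma ConjugatesTo.inv {U : QMatrix n} (hU : IsClifford U) {P Q : PauliOp n}
    (h : ConjugatesTo U P Q) : ConjugatesTo U⁻¹ Q P := by
  obtain ⟨c, hc, h⟩ := h
  refine ⟨c⁻¹, inv_ne_zero hc, ?_⟩
  have hQ : pauliMatrix Q = c⁻¹ • (U * pauliMatrix P * U⁻¹) := by
    rw [h, smul_smul, inv_mul_cancel₀ hc, one_smul]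
  rw [hU.inv_inv, hQ, mul_smul_comm, smul_mul_assoc]
  congr 1
  calc U⁻¹ * (U * pauliMatrix P * U⁻¹) * U
      = (U⁻¹ * U) * pauliMatrix P * (U⁻¹ * U) := by simp only [mul_assoc]
    _ = pauliMatrix P := by rw [hU.inv_mul, one_mul, mul_one]

/-- The inverse of a Clifford unitary also conjugates Pauli operators to Pauli operators. -/
lemma IsClifford.exists_inv {U : QMatrix n} (hU : IsClifford U) (Q : PauliOp n) :
    ∃ P, ConjugatesTo U⁻¹ Q P := by
  choose f hf using hU.2
  have hinj : Function.Injective f := fun P P' h =>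
    ((hf P).inv hU).unique (h ▸ (hf P').inv hU)
  -- There are finitely many Pauli operators up to phase, so the injective map `P ↦ U P U⁻¹` is
  -- onto.
  obtain ⟨P, rfl⟩ := Finite.surjective_of_injective hinj Q
  exact ⟨P, (hf P).inv hU⟩

lemma IsClifford.conjugatesTo_inv {U : QMatrix n} (hU : IsClifford U) (Q : PauliOp n) :
    ConjugatesTo U⁻¹ Q (conjugate U⁻¹ Q) := by
  obtain ⟨P, hP⟩ := hU.exists_inv Q
  rwa [hP.conjugate_eq]

lemma IsClifford.exists_mul_eq {U : QMatrix n} (hU : IsClifford U) (Q : PauliOp n) :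
    ∃ c : ℂ, c ≠ 0 ∧ pauliMatrix Q * U = c • (U * pauliMatrix (conjugate U⁻¹ Q)) := by
  obtain ⟨c, hc, h⟩ := hU.conjugatesTo_inv Q
  refine ⟨c, hc, ?_⟩
  rw [← mul_smul_comm, ← h, hU.inv_inv, ← mul_assoc, ← mul_assoc, hU.mul_inv, one_mul]

lemma IsClifford.one : IsClifford (1 : QMatrix n) :=
  ⟨one_mem _, fun P => ⟨P, 1, one_ne_zero, by simp⟩⟩

lemma IsClifford.mul {U V : QMatrix n} (hU : IsClifford U) (hV : IsClifford V) :
    IsClifford (U * V) := by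
  refine ⟨mul_mem hU.1 hV.1, fun P => ?_⟩
  obtain ⟨Q, c, hc, hQ⟩ := hV.2 P
  obtain ⟨R, d, hd, hR⟩ := hU.2 Q
  refine ⟨R, c * d, mul_ne_zero hc hd, ?_⟩
  rw [Matrix.mul_inv_rev, ← smul_smul, ← hR, ← smul_mul_assoc, ← mul_smul_comm, ← hQ]
  simp only [mul_assoc]

lemma conjugate_one (P : PauliOp n) : conjugate (1 : QMatrix n)⁻¹ P = P :=
  ConjugatesTo.conjugate_eq ⟨1, one_ne_zero, by simp⟩

lemma conjugate_inv_mul {U V : QMatrix n} (hU : IsClifford U) (hV : IsClifford V)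
    (P : PauliOp n) : conjugate (U * V)⁻¹ P = conjugate V⁻¹ (conjugate U⁻¹ P) := by
  refine ConjugatesTo.conjugate_eq ?_
  obtain ⟨c, hc, hQ⟩ := hU.conjugatesTo_inv P
  obtain ⟨d, hd, hR⟩ := hV.conjugatesTo_inv (conjugate U⁻¹ P)
  refine ⟨c * d, mul_ne_zero hc hd, ?_⟩
  rw [Matrix.mul_inv_rev, ← smul_smul, ← hR, ← smul_mul_assoc, ← mul_smul_comm, ← hQ,
    Matrix.mul_inv_rev]
  simp only [mul_assoc]

lemma conjugate_inv_add {U : QMatrix n} (hU : IsClifford U) (P Q : PauliOp n) :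
    conjugate U⁻¹ (P + Q) = conjugate U⁻¹ P + conjugate U⁻¹ Q := by
  refine ConjugatesTo.conjugate_eq ?_
  obtain ⟨c, hc, hP⟩ := hU.conjugatesTo_inv P
  obtain ⟨d, hd, hQ⟩ := hU.conjugatesTo_inv Q
  obtain ⟨e, he, hPQ⟩ := pauliMatrix_mul P Q
  obtain ⟨f, hf, hPQ'⟩ := pauliMatrix_mul (conjugate U⁻¹ P) (conjugate U⁻¹ Q)
  refine ⟨e⁻¹ * (c * (d * f)), by positivity, ?_⟩
  have h1 : pauliMatrix (P + Q) = e⁻¹ • (pauliMatrix P * pauliMatrix Q) := by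
    rw [hPQ, smul_smul, inv_mul_cancel₀ he, one_smul]
  have h2 : U⁻¹ * (pauliMatrix P * pauliMatrix Q) * U⁻¹⁻¹ =
      (U⁻¹ * pauliMatrix P * U⁻¹⁻¹) * (U⁻¹ * pauliMatrix Q * U⁻¹⁻¹) := by
    rw [hU.inv_inv]
    calc _ = U⁻¹ * pauliMatrix P * 1 * pauliMatrix Q * U := by simp only [mul_assoc, one_mul]
      _ = _ := by rw [← hU.mul_inv]; simp only [mul_assoc]
  rw [h1, mul_smul_comm, smul_mul_assoc, h2, hP, hQ, smul_mul_assoc, mul_smul_comm, hPQ',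
    smul_smul, smul_smul, smul_smul]
  congr 1; ring

lemma conjugate_inv_zero {U : QMatrix n} (hU : IsClifford U) : conjugate U⁻¹ 0 = 0 := by
  have h := conjugate_inv_add hU 0 0
  rw [add_zero] at h
  exact left_eq_add.1 h

/-- Pauli operators commute with operators that act on other qubits. -/
lemma ActsOn.commute {U : QMatrix n} {A : Finset (Fin n)} (hA : ActsOn U A) {D : PauliOp n}
    (hD : ∀ q ∈ A, D q = 0) : pauliMatrix D * U = U * pauliMatrix D := by
  obtain ⟨V, hV⟩ := hA
  ext a b
  -- In each product one intermediate index survives: `D` is diagonal on the qubits of `A`, and `U`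
  -- on the others.
  rw [Matrix.mul_apply, Matrix.mul_apply, Finset.sum_eq_single (A.piecewise a b),
    Finset.sum_eq_single (A.piecewise b a)]
  · rw [((hV _ _).1 fun q hq => by simp [hq]), ((hV _ _).1 fun q hq => by simp [hq]), mul_comm]
    have h1 : (fun q : A => A.piecewise a b q) = fun q : A => a q := by ext q; simp
    have h2 : (fun q : A => A.piecewise b a q) = fun q : A => b q := by ext q; simp
    rw [h1, h2]
    congr 1
    refine Finset.prod_congr rfl fun q _ => ?_
    by_cases hq : q ∈ A <;> simp [hq]
    rw [hD q hq, Prod.zero_eq_mk, singlePauli_zero]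
    simp
  · intro c _ hc
    obtain ⟨q, hq⟩ := Function.ne_iff.1 hc
    by_cases hqA : q ∈ A
    · rw [Finset.piecewise_eq_of_mem _ _ _ hqA] at hq
      have : pauliMatrix D c b = 0 := Finset.prod_eq_zero (Finset.mem_univ q) (by
        rw [hD q hqA, Prod.zero_eq_mk, singlePauli_zero, Matrix.one_apply_ne hq])
      rw [this, mul_zero]
    · rw [Finset.piecewise_eq_of_notMem _ _ _ hqA] at hq
      rw [(hV a c).2 ⟨q, hqA, hq.symm⟩, zero_mul]
  · simp
  · intro c _ hc
    obtain ⟨q, hq⟩ := Function.ne_iff.1 hc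
    by_cases hqA : q ∈ A
    · rw [Finset.piecewise_eq_of_mem _ _ _ hqA] at hq
      have : pauliMatrix D a c = 0 := Finset.prod_eq_zero (Finset.mem_univ q) (by
        rw [hD q hqA, Prod.zero_eq_mk, singlePauli_zero, Matrix.one_apply_ne hq.symm])
      rw [this, zero_mul]
    · rw [Finset.piecewise_eq_of_notMem _ _ _ hqA] at hq
      rw [(hV c b).2 ⟨q, hqA, hq⟩, mul_zero]
  · simp

lemma conjugate_inv_eq_self {U : QMatrix n} (hU : IsClifford U) {A : Finset (Fin n)}
    (hA : ActsOn U A) {D : PauliOp n} (hD : ∀ q ∈ A, D q = 0) : conjugate U⁻¹ D = D :=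
  ConjugatesTo.conjugate_eq ⟨1, one_ne_zero, by
    rw [hU.inv_inv, mul_assoc, hA.commute hD, ← mul_assoc, hU.inv_mul, one_mul, one_smul]⟩

lemma symp_conjugate_inv {U : QMatrix n} (hU : IsClifford U) (P R : PauliOp n) :
    symp (conjugate U⁻¹ P) (conjugate U⁻¹ R) = symp P R := by
  apply symp_eq_of_smul_comm
  obtain ⟨c, hc, hP⟩ := hU.conjugatesTo_inv P
  obtain ⟨d, hd, hR⟩ := hU.conjugatesTo_inv R
  rw [hU.inv_inv] at hP hR
  have key : ∀ X Y : QMatrix n, (U⁻¹ * X * U) * (U⁻¹ * Y * U) = U⁻¹ * (X * Y) * U := by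
    intro X Y
    calc _ = U⁻¹ * X * (U * U⁻¹) * Y * U := by simp only [mul_assoc]
      _ = _ := by rw [hU.mul_inv]; simp only [mul_assoc, one_mul]
  have h1 := key (pauliMatrix P) (pauliMatrix R)
  have h2 := key (pauliMatrix R) (pauliMatrix P)
  rw [pauliMatrix_comm P R, mul_smul_comm, smul_mul_assoc, ← h2, hP, hR] at h1
  simp only [smul_mul_assoc, mul_smul_comm, smul_smul] at h1
  have hcd : c * d ≠ 0 := mul_ne_zero hc hd
  have h3 := congrArg (fun M => (c * d)⁻¹ • M) h1
  simp only [smul_smul] at h3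
  rw [mul_comm d c, inv_mul_cancel₀ hcd, one_smul] at h3
  rw [h3]
  congr 1
  field_simp

/-- The component at `q` is determined by commutation with the Pauli operators supported on `q`;
conjugation fixes these and preserves the symplectic form. -/
lemma conjugate_inv_apply_of_notMem {U : QMatrix n} (hU : IsClifford U) {A : Finset (Fin n)}
    (hA : ActsOn U A) (P : PauliOp n) {q : Fin n} (hq : q ∉ A) : conjugate U⁻¹ P q = P q := by
  refine eq_of_singleSymp_eq fun r => ?_
  rw [← symp_single_right, ← symp_single_right, ← symp_conjugate_inv hU P,
    conjugate_inv_eq_self hU hA (D := Pi.single q r)]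
  rintro q' hq'
  exact Pi.single_eq_of_ne (by rintro rfl; exact hq hq') _

/-- The difference `P - P'` is supported off `A`, hence is fixed by conjugation and contributes
nothing on `A`. -/
lemma conjugate_inv_congr {U : QMatrix n} (hU : IsClifford U) {A : Finset (Fin n)}
    (hA : ActsOn U A) {P P' : PauliOp n} (h : ∀ q ∈ A, P q = P' q) {q : Fin n} (hq : q ∈ A) :
    conjugate U⁻¹ P q = conjugate U⁻¹ P' q := by
  have hD : ∀ q ∈ A, (P - P') q = 0 := fun q hq => by simp [h q hq]
  have hP : P = (P - P') + P' := by abel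
  rw [hP, conjugate_inv_add hU, conjugate_inv_eq_self hU hA hD, Pi.add_apply, hD q hq, zero_add]

/-! ### Moving Pauli operators through a single operation. -/

namespace CliffordOp

lemma isClifford_unitary : ∀ a : CliffordOp n, IsClifford a.unitary
  | gate _ _ hU _ => hU
  | meas _ _ => IsClifford.one

lemma actsOn_unitary : ∀ a : CliffordOp n, ActsOn a.unitary a.support
  | gate _ _ _ hA => hA
  | meas s P => by
    refine ⟨1, fun a b => ⟨fun h => ?_, fun ⟨q, _, hq⟩ => ?_⟩⟩
    · by_cases hab : a = b
      · subst hab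
        simp [unitary]
      · obtain ⟨q, hq⟩ := Function.ne_iff.1 hab
        rw [unitary, Matrix.one_apply_ne hab, Matrix.one_apply_ne]
        intro h'
        by_cases hqA : q ∈ (meas s P).support
        · exact hq (congrFun h' ⟨q, hqA⟩)
        · exact hq (h q hqA)
    · exact Matrix.one_apply_ne fun h => hq (congrFun h q)

/-- The map `P ↦ U⁻¹ P U` on Pauli operators up to phase, for the unitary `U` of an operation. -/
def pull (a : CliffordOp n) (P : PauliOp n) : PauliOp n := conjugate a.unitary⁻¹ P

lemma pull_zero (a : CliffordOp n) : a.pull 0 = 0 := conjugate_inv_zero a.isClifford_unitary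

lemma pull_apply_of_notMem (a : CliffordOp n) (P : PauliOp n) {q : Fin n} (hq : q ∉ a.support) :
    a.pull P q = P q :=
  conjugate_inv_apply_of_notMem a.isClifford_unitary a.actsOn_unitary P hq

lemma pull_congr (a : CliffordOp n) {P P' : PauliOp n} (h : ∀ q ∈ a.support, P q = P' q)
    {q : Fin n} (hq : q ∈ a.support) : a.pull P q = a.pull P' q :=
  conjugate_inv_congr a.isClifford_unitary a.actsOn_unitary h hq

lemma measured_apply_of_notMem : ∀ (a : CliffordOp n) {q : Fin n}, q ∉ a.support →
    a.measured q = 0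
  | gate _ _ _ _, _, _ => rfl
  | meas _ P, q, hq => by simpa [support, pauliSupport, measured] using hq

lemma kraus_meas (o s : ZMod 2) (P : PauliOp n) :
    (meas s P).kraus o = (1 / 2 : ℂ) • (1 + sgn (o + s) • pauliMatrix P) := by
  rw [sgn_add, ← smul_smul]
  rfl

lemma kraus_meas_conjTranspose (o s : ZMod 2) (P : PauliOp n) :
    ((meas s P).kraus o)ᴴ = (meas s P).kraus o := by
  rw [kraus_meas, Matrix.conjTranspose_smul, Matrix.conjTranspose_add, Matrix.conjTranspose_smul,
    pauliMatrix_conjTranspose, star_sgn, Matrix.conjTranspose_one]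
  simp

/-- The projector of a measurement absorbs the measured operator up to the sign of the outcome. -/
lemma kraus_meas_mul (o s : ZMod 2) (P : PauliOp n) :
    (meas s P).kraus o * pauliMatrix P = sgn (o + s) • (meas s P).kraus o := by
  have h : (1 + sgn (o + s) • pauliMatrix P) * pauliMatrix P =
      sgn (o + s) • (1 + sgn (o + s) • pauliMatrix P) := by
    rw [add_mul, one_mul, smul_mul_assoc, pauliMatrix_mul_self, smul_add, smul_smul, sgn_mul_self,
      one_smul, add_comm]
  rw [kraus_meas, smul_mul_assoc, h, smul_comm]

/-- An operator anticommuting with the measured one exchanges the projectors of the two outcomes. -/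
lemma mul_kraus_meas (o s : ZMod 2) (P X : PauliOp n) :
    pauliMatrix X * (meas s P).kraus o =
      (meas s P).kraus (symp X P + o) * pauliMatrix X := by
  rw [kraus_meas, kraus_meas, mul_smul_comm, smul_mul_assoc, mul_add, add_mul, mul_one, one_mul,
    mul_smul_comm, smul_mul_assoc, pauliMatrix_comm X P, smul_smul, ← sgn_add]
  congr 4
  ring

lemma kraus_meas_mul_kraus {o o' : ZMod 2} (h : o ≠ o') (s : ZMod 2) (P : PauliOp n) :
    (meas s P).kraus o * (meas s P).kraus o' = 0 := by
  have h1 : sgn (o + s) = - sgn (o' + s) := by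
    rw [sgn_add, sgn_add]
    rcases zmod_two_cases o with rfl | rfl <;> rcases zmod_two_cases o' with rfl | rfl <;>
      simp [sgn_zero, sgn_one] at h ⊢
  rw [kraus_meas o', mul_smul_comm, mul_add, mul_one, mul_smul_comm, kraus_meas_mul, smul_smul,
    h1, mul_neg, sgn_mul_self]
  simp

lemma kraus_eq_of_not : ∀ {a : CliffordOp n}, ¬ a.isMeasurement = true →
    ∀ o o' : ZMod 2, a.kraus o = a.kraus o'
  | gate _ _ _ _, _, _, _ => rfl
  | meas _ _, h, _, _ => absurd rfl h

lemma sum_kraus (a : CliffordOp n) :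
    ∃ c : ℂ, c ≠ 0 ∧ ∑ o, (a.kraus o)ᴴ * a.kraus o = c • (1 : QMatrix n) := by
  cases a with
  | gate A U hU hA =>
    -- A gate ignores its dummy outcome bit, so both values contribute the identity.
    refine ⟨2, two_ne_zero, ?_⟩
    have h : Uᴴ * U = 1 := Matrix.mem_unitaryGroup_iff'.1 hU.1
    simp [kraus, h, two_smul]
  | meas s P =>
    have hsum : ∀ g : ZMod 2 → QMatrix n, ∑ o, g o = g 0 + g 1 := fun g => Fin.sum_univ_two g
    have hpr : ∀ o, ((meas s P).kraus o)ᴴ * (meas s P).kraus o = (meas s P).kraus o := by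
      intro o
      rw [kraus_meas_conjTranspose]
      nth_rw 2 [kraus_meas]
      rw [mul_smul_comm, mul_add, mul_one, mul_smul_comm, kraus_meas_mul, smul_smul,
        sgn_mul_self, one_smul, ← two_smul ℂ, smul_smul]
      norm_num
    refine ⟨1, one_ne_zero, ?_⟩
    rw [hsum, hpr, hpr, kraus_meas, kraus_meas, ← smul_add, sgn_add, sgn_add, sgn_zero, sgn_one]
    have : (1 + (1 * sgn s) • pauliMatrix P + (1 + (-1 * sgn s) • pauliMatrix P) : QMatrix n) =
        (2 : ℂ) • 1 := by
      rw [two_smul, neg_mul, neg_smul]; abel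
    rw [this, smul_smul]
    norm_num

/-- A Pauli operator that commutes with the measured operator can be pulled back through an
operation. -/
lemma mul_kraus_eq (a : CliffordOp n) {w : ZMod 2} (hw : a.isMeasurement = false → w = 0)
    {X : PauliOp n} (h : symp X a.measured = 0) :
    ∃ c : ℂ, c ≠ 0 ∧ ∀ o, pauliMatrix X * a.kraus o =
      (c * sgn (w * o)) • (a.kraus o * pauliMatrix (w • a.measured + a.pull X)) := by
  cases a with
  | gate A U hU hA =>
    obtain ⟨c, hc, hX⟩ := hU.exists_mul_eq X
    obtain rfl := hw rfl
    refine ⟨c, hc, fun o => ?_⟩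
    rw [zero_smul, zero_add, zero_mul, sgn_zero, mul_one]
    exact hX
  | meas s P =>
    have hpull : (meas s P).pull X = X := conjugate_one X
    change symp X P = 0 at h
    rw [hpull]
    rcases zmod_two_cases w with rfl | rfl
    · refine ⟨1, one_ne_zero, fun o => ?_⟩
      rw [zero_smul, zero_add, zero_mul, sgn_zero, mul_one, one_smul, mul_kraus_meas, h, zero_add]
    · obtain ⟨d, hd, hPX⟩ := pauliMatrix_mul P X
      -- The constant must not depend on `o`: it collects the sign of the measured operator and the
      -- phase of the product `P X`.
      refine ⟨sgn s * d, mul_ne_zero (sgn_ne_zero s) hd, fun o => ?_⟩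
      change _ = _ • (_ * pauliMatrix ((1 : ZMod 2) • P + X))
      have e : sgn s * d * sgn o = sgn (o + s) * d := by rw [sgn_add]; ring
      rw [one_smul, one_mul, e, ← smul_smul, ← mul_smul_comm, ← hPX, ← mul_assoc, kraus_meas_mul,
        smul_mul_assoc, smul_smul, sgn_mul_self, one_smul, mul_kraus_meas, h, zero_add]

/-- Moving `X` across flips the outcome of one projector, leaving a product of two orthogonal
projectors. -/
lemma kraus_annihilate (a : CliffordOp n) {X : PauliOp n} (h : symp X a.measured ≠ 0)
    (o : ZMod 2) : (a.kraus o)ᴴ * pauliMatrix X * a.kraus o = 0 := by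
  cases a with
  | gate A U hU hA => exact absurd (by simp [symp, singleSymp, measured]) h
  | meas s P =>
    rw [mul_assoc, mul_kraus_meas, ← mul_assoc, kraus_meas_conjTranspose, kraus_meas_mul_kraus,
      zero_mul]
    exact fun h' => h (left_eq_add.1 (h'.trans (add_comm _ _)))

end CliffordOp

/-! ### Backward sequences and the signed Heisenberg sum. -/

/-- The Pauli operators obtained from the identity by going backward through a sequence of
operations, multiplying by the operators measured by the operations with `w i = 1`. -/
def IsBackSeq {m : ℕ} (op : Fin m → CliffordOp n) (w : Fin m → ZMod 2)
    (X : Fin (m + 1) → PauliOp n) : Prop :=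
  X (Fin.last m) = 0 ∧ ∀ i, X i.castSucc = w i • (op i).measured + (op i).pull (X i.succ)

lemma exists_isBackSeq {m : ℕ} (op : Fin m → CliffordOp n) (w : Fin m → ZMod 2) :
    ∃ X, IsBackSeq op w X := by
  refine ⟨fun k => Fin.reverseInduction (motive := fun _ => PauliOp n) 0
    (fun i G => w i • (op i).measured + (op i).pull G) k, ?_, fun i => ?_⟩
  · simp
  · simp

lemma IsBackSeq.tail {m : ℕ} {op : Fin (m + 1) → CliffordOp n} {w : Fin (m + 1) → ZMod 2}
    {X : Fin (m + 2) → PauliOp n} (h : IsBackSeq op w X) :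
    IsBackSeq (fun i => op i.succ) (fun i => w i.succ) (fun i => X i.succ) :=
  ⟨h.1, fun i => h.2 i.succ⟩

/-- The linear map applied to the state by a sequence of operations with outcomes `f`. -/
def outcomeMap {m : ℕ} (op : Fin m → CliffordOp n) (f : Fin m → ZMod 2) : QMatrix n :=
  ((List.finRange m).reverse.map fun i => (op i).kraus (f i)).prod

lemma outcomeMap_zero (op : Fin 0 → CliffordOp n) (f : Fin 0 → ZMod 2) : outcomeMap op f = 1 := by
  simp [outcomeMap]

lemma outcomeMap_succ {m : ℕ} (op : Fin (m + 1) → CliffordOp n) (f : Fin (m + 1) → ZMod 2) :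
    outcomeMap op f =
      outcomeMap (fun i => op i.succ) (fun i => f i.succ) * (op 0).kraus (f 0) := by
  simp [outcomeMap, List.finRange_succ, List.map_reverse, Function.comp_def]

/-- The identity inserted after the last operation is pulled backward. Each measurement with weight
`1` absorbs its own operator at the cost of the sign of its outcome, and commutation lets the
accumulated operator pass. The constant is the same for all `f`, as the criterion for checks
requires. -/
lemma IsBackSeq.outcomeMap_eq {m : ℕ} {op : Fin m → CliffordOp n} {w : Fin m → ZMod 2}
    {X : Fin (m + 1) → PauliOp n} (hX : IsBackSeq op w X)
    (hw : ∀ i, (op i).isMeasurement = false → w i = 0)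
    (h : ∀ i, symp (X i.succ) (op i).measured = 0) :
    ∃ c : ℂ, c ≠ 0 ∧ ∀ f, outcomeMap op f =
      (c * sgn (w ⬝ᵥ f)) • (outcomeMap op f * pauliMatrix (X 0)) := by
  induction m with
  | zero =>
    refine ⟨1, one_ne_zero, fun f => ?_⟩
    have h0 : X 0 = 0 := hX.1
    rw [h0, pauliMatrix_zero, dotProduct, Finset.univ_eq_empty, Finset.sum_empty, sgn_zero]
    simp
  | succ m ih =>
    obtain ⟨c, hc, hT⟩ := ih hX.tail (fun i => hw i.succ) (fun i => h i.succ)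
    obtain ⟨d, hd, hK⟩ := (op 0).mul_kraus_eq (hw 0) (h 0)
    refine ⟨c * d, mul_ne_zero hc hd, fun f => ?_⟩
    have h0 : X 0 = w 0 • (op 0).measured + (op 0).pull (X (Fin.succ 0)) := hX.2 0
    rw [← h0] at hK
    have hdot : w ⬝ᵥ f = w 0 * f 0 + (fun i => w (Fin.succ i)) ⬝ᵥ fun i => f (Fin.succ i) :=
      Fin.sum_univ_succ _
    rw [outcomeMap_succ]
    nth_rw 1 [hT]
    rw [smul_mul_assoc, mul_assoc, hK, mul_smul_comm, smul_smul, hdot, sgn_add]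
    congr 1
    · ring
    · rw [mul_assoc]

/-- The image of the identity under the signed sum over the outcomes of the Heisenberg picture
maps of a sequence of operations. -/
def heisenberg {m : ℕ} (op : Fin m → CliffordOp n) (w : Fin m → ZMod 2) : QMatrix n :=
  ∑ f : Fin m → ZMod 2, sgn (w ⬝ᵥ f) • ((outcomeMap op f)ᴴ * outcomeMap op f)

lemma heisenberg_zero (op : Fin 0 → CliffordOp n) (w : Fin 0 → ZMod 2) : heisenberg op w = 1 := by
  simp [heisenberg, outcomeMap_zero, dotProduct, sgn_zero]

/-- In the Heisenberg picture the first operation acts last, so it is the outermost sandwich. -/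
lemma heisenberg_succ {m : ℕ} (op : Fin (m + 1) → CliffordOp n) (w : Fin (m + 1) → ZMod 2) :
    heisenberg op w = ∑ o, sgn (w 0 * o) • (((op 0).kraus o)ᴴ *
      heisenberg (fun i => op i.succ) (fun i => w i.succ) * (op 0).kraus o) := by
  rw [heisenberg, ← (Fin.consEquiv fun _ => ZMod 2).sum_comp, Fintype.sum_prod_type]
  refine Finset.sum_congr rfl fun o _ => ?_
  rw [heisenberg, Finset.mul_sum, Finset.sum_mul, Finset.smul_sum]
  refine Finset.sum_congr rfl fun f _ => ?_
  have hdot : w ⬝ᵥ (Fin.cons o f : Fin (m + 1) → ZMod 2) =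
      w 0 * o + (fun i => w (Fin.succ i)) ⬝ᵥ f := by
    simp [dotProduct, Fin.sum_univ_succ]
  change sgn (w ⬝ᵥ (Fin.cons o f : Fin (m + 1) → ZMod 2)) •
    ((outcomeMap op (Fin.cons o f))ᴴ * outcomeMap op (Fin.cons o f)) = _
  rw [hdot, sgn_add, outcomeMap_succ]
  simp only [Fin.cons_zero, Fin.cons_succ]
  rw [Matrix.conjTranspose_mul, mul_smul_comm, smul_mul_assoc, smul_smul]
  simp only [mul_assoc]

lemma heisenberg_weight_zero {m : ℕ} (op : Fin m → CliffordOp n) :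
    ∃ c : ℂ, c ≠ 0 ∧ heisenberg op 0 = c • 1 := by
  induction m with
  | zero => exact ⟨1, one_ne_zero, by rw [heisenberg_zero, one_smul]⟩
  | succ m ih =>
    obtain ⟨c, hc, h⟩ := ih fun i => op i.succ
    obtain ⟨d, hd, hK⟩ := (op 0).sum_kraus
    refine ⟨c * d, mul_ne_zero hc hd, ?_⟩
    rw [heisenberg_succ, ← smul_smul, ← hK, Finset.smul_sum]
    refine Finset.sum_congr rfl fun o _ => ?_
    have h' : heisenberg (fun i => op (Fin.succ i)) (fun i => (0 : Fin (m + 1) → ZMod 2) i.succ) =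
        c • 1 := h
    rw [h', Pi.zero_apply, zero_mul, sgn_zero, one_smul, mul_smul_comm, mul_one, smul_mul_assoc]

/-- The signed sum is proportional to a Pauli operator if no anticommutation is met. -/
lemma IsBackSeq.heisenberg_eq {m : ℕ} {op : Fin m → CliffordOp n} {w : Fin m → ZMod 2}
    {X : Fin (m + 1) → PauliOp n} (hX : IsBackSeq op w X)
    (hw : ∀ i, (op i).isMeasurement = false → w i = 0)
    (h : ∀ i, symp (X i.succ) (op i).measured = 0) :
    ∃ c : ℂ, heisenberg op w = c • pauliMatrix (X 0) := by
  obtain ⟨c, hc, hf⟩ := hX.outcomeMap_eq hw h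
  obtain ⟨d, hd, h0⟩ := heisenberg_weight_zero op
  refine ⟨c * d, ?_⟩
  rw [← smul_smul, ← one_mul (pauliMatrix (X 0)), ← smul_mul_assoc d, ← h0, heisenberg, heisenberg,
    Finset.sum_mul, Finset.smul_sum]
  refine Finset.sum_congr rfl fun f _ => ?_
  -- The sign obtained by extracting `X 0` cancels the weight, leaving the unsigned sum.
  nth_rw 2 [hf f]
  rw [zero_dotProduct, sgn_zero, one_smul, mul_smul_comm, smul_smul, mul_assoc, mul_left_comm,
    sgn_mul_self, mul_one]

/-- The signed sum vanishes if some anticommutation is met. -/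
lemma IsBackSeq.heisenberg_eq_zero {m : ℕ} {op : Fin m → CliffordOp n} {w : Fin m → ZMod 2}
    {X : Fin (m + 1) → PauliOp n} (hX : IsBackSeq op w X)
    (hw : ∀ i, (op i).isMeasurement = false → w i = 0)
    (h : ¬ ∀ i, symp (X i.succ) (op i).measured = 0) : heisenberg op w = 0 := by
  induction m with
  | zero => exact absurd (fun i => i.elim0) h
  | succ m ih =>
    rw [heisenberg_succ]
    refine Finset.sum_eq_zero fun o _ => ?_
    -- Either the tail already vanishes, or it is a multiple of a Pauli operator that anticommutes
    -- with the first measured operator and is annihilated by that measurement.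
    by_cases ht : ∀ i : Fin m, symp (X i.succ.succ) (op i.succ).measured = 0
    · obtain ⟨c, hc⟩ := hX.tail.heisenberg_eq (fun i => hw i.succ) ht
      have h0 : symp (X (Fin.succ 0)) (op 0).measured ≠ 0 := fun h0 =>
        h fun i => Fin.cases h0 ht i
      rw [hc, mul_smul_comm, smul_mul_assoc, (op 0).kraus_annihilate h0, smul_zero, smul_zero]
    · rw [ih hX.tail (fun i => hw i.succ) ht, mul_zero, zero_mul, smul_zero]

/-! ### Checks of the outcome code via the backward sequence. -/

namespace CliffordCircuit

variable (C : CliffordCircuit n)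

/-- Extension of a vector indexed by the measurements by zero on the unitary operations. -/
def extend (u : C.Outcome) (i : Fin C.size) : ZMod 2 :=
  if h : (C.op i).isMeasurement = true then u ⟨i, h⟩ else 0

lemma extend_of_not {u : C.Outcome} {i : Fin C.size} (h : (C.op i).isMeasurement = false) :
    C.extend u i = 0 := by
  rw [extend, dif_neg (by simp [h])]

lemma sum_meas_eq {M : Type*} [AddCommMonoid M] (g : Fin C.size → M)
    (hg : ∀ i, (C.op i).isMeasurement = false → g i = 0) : ∑ j : C.Meas, g j.1 = ∑ i, g i :=
  Fintype.sum_of_injective Subtype.val Subtype.val_injective _ g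
    (fun i hi => hg i (by simpa using hi)) fun _ => rfl

lemma extend_meas (u : C.Outcome) (j : C.Meas) : C.extend u j.1 = u j := dif_pos j.2

lemma extend_dotProduct (u o : C.Outcome) : C.extend u ⬝ᵥ C.extend o = u ⬝ᵥ o := by
  rw [dotProduct, ← C.sum_meas_eq _ fun i hi => by rw [C.extend_of_not hi, zero_mul]]
  simp only [extend_meas]
  rfl

lemma krausProd_eq (o : C.Outcome) : C.krausProd o = outcomeMap C.op (C.extend o) := rfl

lemma outcomeMap_eq_krausProd (f : Fin C.size → ZMod 2) :
    outcomeMap C.op f = C.krausProd fun j => f j.1 := by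
  rw [krausProd, outcomeMap]
  congr 2
  funext i
  rw [krausAt]
  by_cases h : (C.op i).isMeasurement = true
  · rw [dif_pos h]
  · exact CliffordOp.kraus_eq_of_not h _ _

/-- The maximally mixed state detects every nonzero `K`: its outcome probability is `tr (K K†)`
divided by the dimension. -/
lemma mem_outcomeCode (o : C.Outcome) : o ∈ C.outcomeCode ↔ C.krausProd o ≠ 0 := by
  constructor
  · rintro ⟨ρ, -, -, h⟩ h0
    simp [outcomeProb, h0] at h
  · intro h
    set K := C.krausProd o
    set N : ℝ := ((Fintype.card (Fin n → Fin 2) : ℕ) : ℝ)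
    have hN : 0 < N := Nat.cast_pos.2 Fintype.card_pos
    have htr : 0 < (K * Kᴴ).trace := lt_of_le_of_ne
      (Matrix.posSemidef_self_mul_conjTranspose K).trace_nonneg
      fun h' => h (Matrix.trace_mul_conjTranspose_self_eq_zero_iff.1 h'.symm)
    refine ⟨((N⁻¹ : ℝ) : ℂ) • 1, Matrix.PosSemidef.one.smul ?_, ?_, ?_⟩
    · exact_mod_cast (inv_pos.2 hN).le
    · rw [Matrix.trace_smul, Matrix.trace_one, smul_eq_mul]
      simp only [N, Complex.ofReal_inv, Complex.ofReal_natCast]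
      exact inv_mul_cancel₀ (Nat.cast_ne_zero.2 Fintype.card_ne_zero)
    · change 0 < (Matrix.trace (K * _ * Kᴴ)).re
      rw [mul_smul_comm, mul_one, smul_mul_assoc, Matrix.trace_smul, smul_eq_mul,
        Complex.re_ofReal_mul]
      exact mul_pos (inv_pos.2 hN) (Complex.pos_iff.1 htr).1

/-- The checks of the outcome code in terms of the backward sequence of Pauli operators. -/
lemma mem_checks_iff_of_isBackSeq (hlin : C.HasLinearOutcomeCode) {u : C.Outcome}
    {X : Fin (C.size + 1) → PauliOp n} (hX : IsBackSeq C.op (C.extend u) X) :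
    u ∈ C.checks ↔ (∀ i, symp (X i.succ) (C.op i).measured = 0) ∧ X 0 = 0 := by
  have hw : ∀ i, (C.op i).isMeasurement = false → C.extend u i = 0 := fun i => C.extend_of_not
  obtain ⟨d, hd, h0⟩ := heisenberg_weight_zero C.op
  have hone : (1 : QMatrix n) ≠ 0 := one_ne_zero
  constructor
  · intro hu
    have hf : ∀ f, outcomeMap C.op f ≠ 0 → sgn (C.extend u ⬝ᵥ f) = 1 := by
      intro f hf
      rw [outcomeMap_eq_krausProd] at hf
      have h1 := hu _ ((C.mem_outcomeCode _).2 hf)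
      rw [← C.extend_dotProduct] at h1
      rw [← sgn_zero, ← h1]
      congr 1
      refine Finset.sum_congr rfl fun i _ => ?_
      by_cases hi : (C.op i).isMeasurement = true
      · simp [extend, hi]
      · rw [hw i (by simpa using hi), zero_mul, zero_mul]
    -- For a check, every nonvanishing term carries the sign `1`, so weighting by `u` changes
    -- nothing.
    have hE : heisenberg C.op (C.extend u) = heisenberg C.op 0 := by
      refine Finset.sum_congr rfl fun f _ => ?_
      by_cases h : outcomeMap C.op f = 0
      · simp [h]
      · rw [hf f h, zero_dotProduct, sgn_zero]
    have hgood : ∀ i, symp (X i.succ) (C.op i).measured = 0 := by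
      by_contra hbad
      rw [hX.heisenberg_eq_zero hw hbad, h0] at hE
      exact smul_ne_zero hd hone hE.symm
    refine ⟨hgood, ?_⟩
    obtain ⟨c, hc⟩ := hX.heisenberg_eq hw hgood
    rw [hE, h0, ← pauliMatrix_zero] at hc
    exact (eq_of_smul_pauliMatrix_eq hd hc).symm
  · rintro ⟨hgood, hX0⟩ o ho
    obtain ⟨c, -, hc⟩ := hX.outcomeMap_eq hw hgood
    simp only [hX0, pauliMatrix_zero, mul_one] at hc
    have key : ∀ o ∈ C.outcomeCode, c * sgn (u ⬝ᵥ o) = 1 := by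
      intro o ho
      have h1 := hc (C.extend o)
      rw [← krausProd_eq, C.extend_dotProduct] at h1
      have hne := (C.mem_outcomeCode o).1 ho
      refine smul_left_injective ℂ hne ?_
      simpa using h1.symm
    obtain ⟨W, hW⟩ := hlin
    -- Linearity enters only through this: the zero outcome normalizes `c` to `1`.
    have hz : (0 : C.Outcome) ∈ C.outcomeCode := hW ▸ W.zero_mem
    have hc1 := key 0 hz
    rw [dotProduct_zero, sgn_zero, mul_one] at hc1
    have := key o ho
    rw [hc1, one_mul] at this
    exact sgn_eq_one this

/-! ### Locality of the back-cumulant recursion. -/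

/-- The blockwise form of the recursion that defines the back-cumulants of the faults `F(u)`, with
`w` the extension of `u` by zero. -/
structure IsConsistent (w : Fin C.size → ZMod 2) (G : C.Fault) : Prop where
  last : G (Fin.last C.depth) = 0
  block : ∀ (k : Fin C.depth) (i : Fin C.size), C.level i = k + 1 → ∀ q ∈ (C.op i).support,
    G k.castSucc q = (w i • (C.op i).measured + (C.op i).pull (G k.succ)) q
  idle : ∀ (k : Fin C.depth) (q : Fin n), (∀ i, C.level i = k + 1 → q ∉ (C.op i).support) →
    G k.castSucc q = G k.succ q

lemma level_le_depth (i : Fin C.size) : C.level i ≤ C.depth :=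
  Finset.le_sup (f := C.level) (Finset.mem_univ i)

lemma eq_of_mem_support {i j : Fin C.size} (h : C.level i = C.level j) {q : Fin n}
    (hi : q ∈ (C.op i).support) (hj : q ∈ (C.op j).support) : i = j := by
  by_contra hij
  exact Finset.disjoint_left.1 (C.disjoint_support i j hij h) hi hj

lemma measFault_last (u : C.Outcome) : C.measFault u (Fin.last C.depth) = 0 := by
  refine Finset.sum_eq_zero fun j _ => if_neg ?_
  have := C.level_le_depth j.1
  rw [Fin.val_last]
  omega

lemma measFault_eq (u : C.Outcome) (k : Fin (C.depth + 1)) :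
    C.measFault u k =
      ∑ i, if (k : ℕ) + 1 = C.level i then C.extend u i • (C.op i).measured else 0 := by
  rw [← C.sum_meas_eq _ fun i hi => by rw [C.extend_of_not hi, zero_smul, ite_self]]
  simp only [extend_meas]
  rfl

lemma measFault_apply_block (u : C.Outcome) (k : Fin (C.depth + 1)) {i : Fin C.size}
    (hi : C.level i = k + 1) {q : Fin n} (hq : q ∈ (C.op i).support) :
    C.measFault u k q = (C.extend u i • (C.op i).measured) q := by
  rw [measFault_eq, Finset.sum_apply, Finset.sum_eq_single i, if_pos hi.symm]
  · intro j _ hj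
    split_ifs with h
    · rw [Pi.smul_apply, (C.op j).measured_apply_of_notMem, smul_zero]
      exact fun hqj => hj (C.eq_of_mem_support (h.symm.trans hi.symm) hqj hq)
    · rfl
  · simp

lemma measFault_apply_idle (u : C.Outcome) (k : Fin (C.depth + 1)) {q : Fin n}
    (hq : ∀ i, C.level i = k + 1 → q ∉ (C.op i).support) : C.measFault u k q = 0 := by
  rw [measFault_eq, Finset.sum_apply]
  refine Finset.sum_eq_zero fun j _ => ?_
  split_ifs with h
  · rw [Pi.smul_apply, (C.op j).measured_apply_of_notMem (hq j h.symm), smul_zero]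
  · rfl

/-- The product of the unitaries of level `ℓ` among the operations of a list. -/
def listUnitary (ℓ : ℕ) (L : List (Fin C.size)) : QMatrix n :=
  (L.reverse.map (fun i => if C.level i = ℓ then (C.op i).unitary else 1)).prod

lemma listUnitary_cons (ℓ : ℕ) (j : Fin C.size) (L : List (Fin C.size)) :
    C.listUnitary ℓ (j :: L) =
      C.listUnitary ℓ L * if C.level j = ℓ then (C.op j).unitary else 1 := by
  simp [listUnitary]

lemma isClifford_listUnitary (ℓ : ℕ) (L : List (Fin C.size)) : IsClifford (C.listUnitary ℓ L) := by
  induction L with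
  | nil => simpa [listUnitary] using IsClifford.one
  | cons j L ih =>
    rw [listUnitary_cons]
    refine ih.mul ?_
    split_ifs
    exacts [(C.op j).isClifford_unitary, IsClifford.one]

lemma conjugate_listUnitary_cons (ℓ : ℕ) (j : Fin C.size) (L : List (Fin C.size))
    (P : PauliOp n) : conjugate (C.listUnitary ℓ (j :: L))⁻¹ P =
      if C.level j = ℓ then (C.op j).pull (conjugate (C.listUnitary ℓ L)⁻¹ P)
      else conjugate (C.listUnitary ℓ L)⁻¹ P := by
  rw [listUnitary_cons]
  split_ifs
  · rw [conjugate_inv_mul (C.isClifford_listUnitary ℓ L) (C.op j).isClifford_unitary]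
    rfl
  · rw [mul_one]

lemma conjugate_listUnitary_apply_idle (ℓ : ℕ) (L : List (Fin C.size)) (P : PauliOp n) {q : Fin n}
    (hq : ∀ i ∈ L, C.level i = ℓ → q ∉ (C.op i).support) :
    conjugate (C.listUnitary ℓ L)⁻¹ P q = P q := by
  induction L with
  | nil => simpa [listUnitary] using congrFun (conjugate_one P) q
  | cons j L ih =>
    have ih' := ih fun i hi => hq i (List.mem_cons_of_mem j hi)
    rw [conjugate_listUnitary_cons]
    split_ifs with h
    · rw [(C.op j).pull_apply_of_notMem _ (hq j List.mem_cons_self h), ih']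
    · exact ih'

/-- The other operations of the level have disjoint supports, so they leave the components on the
support of `i` alone, whether they are pulled through before or after it. -/
lemma conjugate_listUnitary_apply_block (ℓ : ℕ) (L : List (Fin C.size)) (hL : L.Nodup)
    (P : PauliOp n) {i : Fin C.size} (hi : i ∈ L) (hil : C.level i = ℓ) {q : Fin n}
    (hq : q ∈ (C.op i).support) : conjugate (C.listUnitary ℓ L)⁻¹ P q = (C.op i).pull P q := by
  induction L with
  | nil => simp at hi
  | cons j L ih =>
    obtain ⟨hjL, hL⟩ := List.nodup_cons.1 hL
    rw [conjugate_listUnitary_cons]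
    rcases List.mem_cons.1 hi with rfl | hi
    · rw [if_pos hil]
      refine (C.op i).pull_congr (fun q' hq' => ?_) hq
      refine C.conjugate_listUnitary_apply_idle ℓ L P fun j hj hjl hqj => hjL ?_
      rwa [C.eq_of_mem_support (hil.trans hjl.symm) hq' hqj]
    · split_ifs with h
      · rw [(C.op j).pull_apply_of_notMem, ih hL hi]
        intro hqj
        exact hjL (C.eq_of_mem_support (h.trans hil.symm) hqj hq ▸ hi)
      · exact ih hL hi

lemma conjugate_levelUnitary_apply_idle (ℓ : ℕ) (P : PauliOp n) {q : Fin n}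
    (hq : ∀ i, C.level i = ℓ → q ∉ (C.op i).support) :
    conjugate (C.levelUnitary ℓ)⁻¹ P q = P q :=
  C.conjugate_listUnitary_apply_idle ℓ _ P fun i _ => hq i

lemma conjugate_levelUnitary_apply_block (ℓ : ℕ) (P : PauliOp n) {i : Fin C.size}
    (hil : C.level i = ℓ) {q : Fin n} (hq : q ∈ (C.op i).support) :
    conjugate (C.levelUnitary ℓ)⁻¹ P q = (C.op i).pull P q :=
  C.conjugate_listUnitary_apply_block ℓ _ (List.nodup_finRange _) P (List.mem_finRange i) hil hq

lemma backCumulant_last (F : C.Fault) :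
    C.backCumulant F (Fin.last C.depth) = F (Fin.last C.depth) := by
  simp [backCumulant]

lemma backCumulant_castSucc (F : C.Fault) (k : Fin C.depth) :
    C.backCumulant F k.castSucc = F k.castSucc +
      conjugate (C.levelUnitary (k + 1))⁻¹ (C.backCumulant F k.succ) := by
  simp [backCumulant]

lemma isConsistent_backCumulant (u : C.Outcome) :
    C.IsConsistent (C.extend u) (C.backCumulant (C.measFault u)) where
  last := by rw [backCumulant_last, measFault_last]
  block k i hi q hq := by
    rw [backCumulant_castSucc, Pi.add_apply, Pi.add_apply, C.measFault_apply_block u _ hi hq,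
      C.conjugate_levelUnitary_apply_block _ _ hi hq]
  idle k q hq := by
    rw [backCumulant_castSucc, Pi.add_apply, C.measFault_apply_idle u _ hq,
      C.conjugate_levelUnitary_apply_idle _ _ hq, zero_add]

variable {C}

/-- Serves to recognize a restricted operator as a back-cumulant. -/
lemma IsConsistent.unique {w : Fin C.size → ZMod 2} {G G' : C.Fault} (h : C.IsConsistent w G)
    (h' : C.IsConsistent w G') : G = G' := by
  funext k
  induction k using Fin.reverseInduction with
  | last => rw [h.last, h'.last]
  | cast k ih =>
    funext q
    by_cases hq : ∀ i, C.level i = k + 1 → q ∉ (C.op i).support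
    · rw [h.idle k q hq, h'.idle k q hq, ih]
    · push Not at hq
      obtain ⟨i, hi, hq⟩ := hq
      rw [h.block k i hi q hq, h'.block k i hi q hq, ih]

lemma IsConsistent.idle_of_le {w : Fin C.size → ZMod 2} {G : C.Fault} (h : C.IsConsistent w G)
    {q : Fin n} (a b : ℕ) (hab : a ≤ b) (hb : b < C.depth + 1)
    (hq : ∀ i, q ∈ (C.op i).support → ¬ (a < C.level i ∧ C.level i ≤ b)) :
    G ⟨a, hab.trans_lt hb⟩ q = G ⟨b, hb⟩ q := by
  induction b, hab using Nat.le_induction with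
  | base => rfl
  | succ b hab ih =>
    rw [ih (by omega) fun i hi hl => hq i hi ⟨hl.1, by omega⟩]
    exact h.idle ⟨b, by omega⟩ q fun i hi hqi => hq i hqi ⟨by simp only at hi; omega, hi.le⟩

/-- The Pauli operators of the backward sequence are made of the components of the back-cumulant. -/
lemma IsConsistent.isBackSeq_apply {w : Fin C.size → ZMod 2} {G : C.Fault}
    (h : C.IsConsistent w G) {X : Fin (C.size + 1) → PauliOp n} (hX : IsBackSeq C.op w X)
    (i : Fin (C.size + 1)) (ℓ : Fin (C.depth + 1)) (q : Fin n)
    (hi : ∀ j, q ∈ (C.op j).support → (C.level j ≤ ℓ ↔ (j : ℕ) < i)) : X i q = G ℓ q := by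
  -- Hypothesis `hi` says that position `i` and time `ℓ + 0.5` cut the wire of `q` at the same
  -- place. Time and qubit must vary, since pulling through an operation involves its whole support.
  induction i using Fin.reverseInduction generalizing ℓ q with
  | last =>
    rw [hX.1, ← h.last]
    refine (h.idle_of_le ℓ C.depth (Nat.lt_succ_iff.1 ℓ.2) (Nat.lt_succ_self _)
      fun j hj hl => ?_).symm
    exact hl.1.not_ge ((hi j hj).2 j.2)
  | cast i ih =>
    have hne : ∀ j : Fin C.size, j ≠ i → ((j : ℕ) < i.castSucc ↔ (j : ℕ) < i.succ) := by
      intro j hj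
      have : (j : ℕ) ≠ i := fun h => hj (Fin.ext h)
      simp only [Fin.val_castSucc, Fin.val_succ]
      omega
    rw [hX.2]
    by_cases hq : q ∈ (C.op i).support
    · have h1 := C.one_le_level i
      have h2 := C.level_le_depth i
      have hlt : (ℓ : ℕ) < C.level i := by
        by_contra hcon
        exact lt_irrefl _ ((hi i hq).1 (not_lt.1 hcon))
      -- The time right before operation `i`; nothing acts on `q` between time `ℓ` and this one.
      set k : Fin C.depth := ⟨C.level i - 1, by omega⟩ with hk
      have hki : C.level i = k + 1 := by simp only [hk]; omega
      have hG : G ℓ q = G k.castSucc q := by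
        refine h.idle_of_le ℓ k (by omega) (by omega) fun j hj hl => ?_
        have h3 : ¬ (j : ℕ) < i := fun h3 => hl.1.not_ge ((hi j hj).2 h3)
        have := C.chronological (Fin.le_def.2 (not_lt.1 h3))
        omega
      rw [hG, h.block k i hki q hq, Pi.add_apply, Pi.add_apply]
      congr 1
      refine (C.op i).pull_congr (fun q' hq' => ih k.succ q' fun j hj => ?_) hq
      rw [Fin.val_succ, Fin.val_succ, ← hki]
      constructor
      · intro hl
        by_contra hcon
        have hij : i ≤ j := Fin.le_def.2 (by omega)
        have heq := C.eq_of_mem_support (le_antisymm (C.chronological hij) hl) hq' hj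
        subst heq
        omega
      · intro hl
        exact C.chronological (Fin.le_def.2 (by omega))
    · rw [Pi.add_apply, Pi.smul_apply, (C.op i).measured_apply_of_notMem hq, smul_zero, zero_add,
        (C.op i).pull_apply_of_notMem _ hq]
      refine ih ℓ q fun j hj => ?_
      rw [hi j hj]
      exact hne j (by rintro rfl; exact hq hj)

lemma symp_congr {P P' : PauliOp n} {a : CliffordOp n} (h : ∀ q ∈ a.support, P q = P' q) :
    symp P a.measured = symp P' a.measured := by
  refine Finset.sum_congr rfl fun q _ => ?_
  by_cases hq : q ∈ a.support
  · rw [h q hq]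
  · rw [a.measured_apply_of_notMem hq]
    simp [singleSymp]

/-- The checks of the outcome code in terms of the back-cumulant. -/
lemma IsConsistent.mem_checks_iff (hlin : C.HasLinearOutcomeCode) {u : C.Outcome} {G : C.Fault}
    (h : C.IsConsistent (C.extend u) G) : u ∈ C.checks ↔
      (∀ (k : Fin C.depth) (i : Fin C.size), C.level i = k + 1 →
        symp (G k.succ) (C.op i).measured = 0) ∧ G 0 = 0 := by
  obtain ⟨X, hX⟩ := exists_isBackSeq C.op (C.extend u)
  -- All levels are at least `1`, so no operation precedes either cut.
  have h0 : X 0 = G 0 := funext fun q => h.isBackSeq_apply hX 0 0 q fun j _ => by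
    have := C.one_le_level j
    simp only [Fin.val_zero]
    omega
  have hs : ∀ (k : Fin C.depth) (i : Fin C.size), C.level i = k + 1 →
      symp (X i.succ) (C.op i).measured = symp (G k.succ) (C.op i).measured := by
    intro k i hki
    refine symp_congr fun q hq => h.isBackSeq_apply hX i.succ k.succ q fun j hj => ?_
    rw [Fin.val_succ, Fin.val_succ, ← hki]
    constructor
    · intro hl
      by_contra hcon
      have hij : i ≤ j := Fin.le_def.2 (by omega)
      -- A later operation of the same level sharing the qubit `q` would have to be `i` itself.
      have heq := C.eq_of_mem_support (le_antisymm (C.chronological hij) hl) hq hj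
      subst heq
      omega
    · intro hl
      exact C.chronological (Fin.le_def.2 (by omega))
  rw [C.mem_checks_iff_of_isBackSeq hlin hX, h0]
  refine and_congr_left fun _ => ⟨fun hg k i hki => (hs k i hki) ▸ hg i, fun hg i => ?_⟩
  have h1 := C.one_le_level i
  have h2 := C.level_le_depth i
  have hki : C.level i = ((⟨C.level i - 1, by omega⟩ : Fin C.depth) : ℕ) + 1 := by
    simp only; omega
  rw [hs _ i hki]
  exact hg _ i hki

/-! ### Components of the support and restrictions. -/

lemma IsSupportComponent.subset {F : C.Fault} {κ : Set C.Vertex} (hκ : C.IsSupportComponent F κ) :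
    κ ⊆ C.vertexSupport F := by
  obtain ⟨c, rfl⟩ := hκ
  rintro _ ⟨v, -, rfl⟩
  exact v.2

lemma IsSupportComponent.mem_of_adj {F : C.Fault} {κ : Set C.Vertex}
    (hκ : C.IsSupportComponent F κ) {v w : C.Vertex} (hv : v ∈ κ) (hw : w ∈ C.vertexSupport F)
    (h : C.spacetimeGraph.Adj v w) : w ∈ κ := by
  obtain ⟨c, rfl⟩ := hκ
  obtain ⟨v, hv, rfl⟩ := hv
  refine ⟨⟨w, hw⟩, ?_, rfl⟩
  exact SimpleGraph.ConnectedComponent.mem_supp_of_adj_mem_supp c hv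
    (SimpleGraph.induce_adj.2 h)

lemma IsSupportComponent.eq_of_mem {F : C.Fault} {κ κ' : Set C.Vertex}
    (hκ : C.IsSupportComponent F κ) (hκ' : C.IsSupportComponent F κ') {v : C.Vertex} (hv : v ∈ κ)
    (hv' : v ∈ κ') : κ = κ' := by
  obtain ⟨c, rfl⟩ := hκ
  obtain ⟨c', rfl⟩ := hκ'
  obtain ⟨v, hv, rfl⟩ := hv
  obtain ⟨v', hv', hvv'⟩ := hv'
  obtain rfl := Subtype.ext hvv'
  rw [SimpleGraph.ConnectedComponent.mem_supp_iff] at hv hv'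
  rw [← hv, ← hv']

lemma exists_isSupportComponent {F : C.Fault} {v : C.Vertex} (hv : v ∈ C.vertexSupport F) :
    ∃ κ, C.IsSupportComponent F κ ∧ v ∈ κ :=
  ⟨_, ⟨SimpleGraph.connectedComponentMk _ ⟨v, hv⟩, rfl⟩, ⟨v, hv⟩, rfl, rfl⟩

lemma IsSupportComponent.connected {F : C.Fault} {κ : Set C.Vertex}
    (hκ : C.IsSupportComponent F κ) : (C.spacetimeGraph.induce κ).Connected := by
  obtain ⟨c, rfl⟩ := hκ
  let f : c.toSimpleGraph →g C.spacetimeGraph.induce (Subtype.val '' c.supp) :=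
    { toFun := fun x => ⟨x.1.1, x.1, x.2, rfl⟩
      map_rel' := fun h => h }
  refine c.connected_toSimpleGraph.map f ?_
  rintro ⟨_, v, hv, rfl⟩
  exact ⟨⟨v, hv⟩, rfl⟩

lemma restrict_last (F : C.Fault) (κ : Set C.Vertex) : C.restrict F κ (Fin.last C.depth) = 0 := by
  funext q
  refine if_neg ?_
  rintro ⟨v, -, hv, -⟩
  exact (Fin.castSucc_lt_last v.1).ne hv

lemma restrict_of_mem (F : C.Fault) {κ : Set C.Vertex} {v : C.Vertex} (hv : v ∈ κ) :
    C.restrict F κ v.1.castSucc v.2 = F v.1.castSucc v.2 :=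
  if_pos ⟨v, hv, rfl, rfl⟩

lemma restrict_of_notMem (F : C.Fault) {κ : Set C.Vertex} {v : C.Vertex} (hv : v ∉ κ) :
    C.restrict F κ v.1.castSucc v.2 = 0 := by
  refine if_neg ?_
  rintro ⟨w, hw, h1, h2⟩
  exact hv (Prod.ext (Fin.castSucc_injective _ h1) h2 ▸ hw)

lemma restrict_ne_zero {F : C.Fault} {κ : Set C.Vertex} {k : Fin (C.depth + 1)} {q : Fin n}
    (h : C.restrict F κ k q ≠ 0) : ∃ v ∈ κ, v.1.castSucc = k ∧ v.2 = q := by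
  by_contra hcon
  exact h (if_neg hcon)

lemma IsSupportComponent.vertexSupport_restrict {F : C.Fault} {κ : Set C.Vertex}
    (hκ : C.IsSupportComponent F κ) : C.vertexSupport (C.restrict F κ) = κ := by
  ext v
  by_cases hv : v ∈ κ
  · exact iff_of_true ((C.restrict_of_mem F hv).trans_ne (hκ.subset hv)) hv
  · exact iff_of_false (fun h => h (C.restrict_of_notMem F hv)) hv

/-- On the qubits that are processed together at a level, before and after that level, the
restriction to a component is either the whole operator or the identity. -/
lemma IsSupportComponent.restrict_apply_block {F : C.Fault} (hF : F (Fin.last C.depth) = 0)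
    {κ : Set C.Vertex} (hκ : C.IsSupportComponent F κ) {ℓ : ℕ} {A : Finset (Fin n)}
    (hA : C.IsBlock ℓ A) {q : Fin n} (hq : q ∈ A) {k : Fin (C.depth + 1)}
    (hk : (k : ℕ) + 1 = ℓ ∨ (k : ℕ) = ℓ) :
    ((∃ v ∈ κ, C.Touches ℓ A v) → C.restrict F κ k q = F k q) ∧
      ((¬ ∃ v ∈ κ, C.Touches ℓ A v) → C.restrict F κ k q = 0) := by
  induction k using Fin.lastCases with
  -- The last time carries no vertices; the claim survives because `F` is trivial there.
  | last => simp [restrict_last, hF]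
  | cast k =>
    have ht : C.Touches ℓ A (k, q) := ⟨hk, hq⟩
    constructor
    · rintro ⟨v, hv, hvt⟩
      by_cases hmem : (k, q) ∈ κ
      · exact C.restrict_of_mem F hmem
      · rw [C.restrict_of_notMem F hmem]
        -- Otherwise this is a support vertex in the same clique as `v ∈ κ`, hence in `κ`.
        by_contra h0
        have hne : v ≠ (k, q) := by rintro rfl; exact hmem hv
        exact hmem (hκ.mem_of_adj hv (Ne.symm h0) ⟨hne, ℓ, A, hA, hvt, ht⟩)
    · intro h
      exact C.restrict_of_notMem F (v := (k, q)) fun hv => h ⟨_, hv, ht⟩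

/-! ### Restriction of stabilizers to components. -/

open Classical in
/-- The part of `u` on the measurements that touch `κ`. -/
def outcomePart (u : C.Outcome) (κ : Set C.Vertex) : C.Outcome := fun j =>
  if ∃ v ∈ κ, C.Touches (C.level j.1) (C.op j.1).support v then u j else 0

lemma extend_outcomePart_of_touches (u : C.Outcome) {κ : Set C.Vertex} {i : Fin C.size}
    (h : ∃ v ∈ κ, C.Touches (C.level i) (C.op i).support v) :
    C.extend (outcomePart u κ) i = C.extend u i := by
  rw [extend, extend]
  split_ifs
  exacts [if_pos h, rfl]

lemma extend_outcomePart_of_not_touches (u : C.Outcome) {κ : Set C.Vertex} {i : Fin C.size}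
    (h : ¬ ∃ v ∈ κ, C.Touches (C.level i) (C.op i).support v) :
    C.extend (outcomePart u κ) i = 0 := by
  rw [extend]
  split_ifs
  exacts [if_neg h, rfl]

/-- Each equation of the recursion lives on one block. If the block touches `κ`, the equation is
that of `G`; otherwise both its operators and its weight become trivial. -/
lemma IsConsistent.restrict {u : C.Outcome} {G : C.Fault} (h : C.IsConsistent (C.extend u) G)
    {κ : Set C.Vertex} (hκ : C.IsSupportComponent G κ) :
    C.IsConsistent (C.extend (outcomePart u κ)) (C.restrict G κ) where
  last := C.restrict_last G κ
  block k i hi q hq := by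
    have hblock : C.IsBlock (C.level i) (C.op i).support := Or.inl ⟨i, rfl, rfl⟩
    have h1 := hκ.restrict_apply_block h.last hblock hq (k := k.castSucc) (Or.inl hi.symm)
    have h2 := fun q' (hq' : q' ∈ (C.op i).support) =>
      hκ.restrict_apply_block h.last hblock hq' (k := k.succ) (Or.inr hi.symm)
    by_cases ht : ∃ v ∈ κ, C.Touches (C.level i) (C.op i).support v
    · rw [h1.1 ht, h.block k i hi q hq, C.extend_outcomePart_of_touches u ht, Pi.add_apply,
        Pi.add_apply, (C.op i).pull_congr (fun q' hq' => (h2 q' hq').1 ht) hq]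
    · rw [h1.2 ht, C.extend_outcomePart_of_not_touches u ht, zero_smul, zero_add,
        (C.op i).pull_congr (P' := 0) (fun q' hq' => (h2 q' hq').2 ht) hq, (C.op i).pull_zero]
      rfl
  idle k q hq := by
    -- The identity on an idle qubit counts as a block, so a component cannot be cut along an idle
    -- wire.
    have hblock : C.IsBlock (k + 1) {q} := Or.inr ⟨q, ⟨by omega, k.2, hq⟩, rfl⟩
    have h1 := hκ.restrict_apply_block h.last hblock (Finset.mem_singleton_self q)
      (k := k.castSucc) (Or.inl rfl)
    have h2 := hκ.restrict_apply_block h.last hblock (Finset.mem_singleton_self q)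
      (k := k.succ) (Or.inr rfl)
    by_cases ht : ∃ v ∈ κ, C.Touches (k + 1) {q} v
    · rw [h1.1 ht, h2.1 ht, h.idle k q hq]
    · rw [h1.2 ht, h2.2 ht]

lemma restrict_eq_zero {F : C.Fault} (κ : Set C.Vertex) {k : Fin (C.depth + 1)} {q : Fin n}
    (h : F k q = 0) : C.restrict F κ k q = 0 := by
  rw [CliffordCircuit.restrict, h, ite_self]

lemma IsStabilizer.last {S : C.Fault} (hS : C.IsStabilizer S) : S (Fin.last C.depth) = 0 := by
  obtain ⟨u, -, rfl⟩ := hS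
  exact (C.isConsistent_backCumulant u).last

/-- The commutation condition at a measurement sees only the values on its support right after it,
where the restriction is either `S` or trivial; triviality at the initial time is inherited. Thus
`outcomePart u κ` is again a check. -/
lemma IsStabilizer.restrict (hlin : C.HasLinearOutcomeCode) {S : C.Fault}
    (hS : C.IsStabilizer S) {κ : Set C.Vertex} (hκ : C.IsSupportComponent S κ) :
    C.IsStabilizer (C.restrict S κ) := by
  obtain ⟨u, hu, rfl⟩ := hS
  have hc := C.isConsistent_backCumulant u
  have hr := hc.restrict hκ
  refine ⟨outcomePart u κ, ?_, hr.unique (C.isConsistent_backCumulant _)⟩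
  obtain ⟨hcomm, h0⟩ := (hc.mem_checks_iff hlin).1 hu
  refine (hr.mem_checks_iff hlin).2 ⟨fun k i hi => ?_, ?_⟩
  · have h2 := fun q (hq : q ∈ (C.op i).support) =>
      hκ.restrict_apply_block hc.last (Or.inl ⟨i, rfl, rfl⟩) hq (k := k.succ) (Or.inr hi.symm)
    by_cases ht : ∃ v ∈ κ, C.Touches (C.level i) (C.op i).support v
    · rw [symp_congr fun q hq => (h2 q hq).1 ht, hcomm k i hi]
    · rw [symp_congr (P' := 0) fun q hq => (h2 q hq).2 ht, symp_zero_left]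
  · funext q
    exact restrict_eq_zero κ (congrFun h0 q)

lemma IsStabilizer.isConnectedStabilizer_restrict (hlin : C.HasLinearOutcomeCode) {S : C.Fault}
    (hS : C.IsStabilizer S) {κ : Set C.Vertex} (hκ : C.IsSupportComponent S κ) :
    C.IsConnectedStabilizer (C.restrict S κ) := by
  refine ⟨hS.restrict hlin hκ, C.restrict_last S κ, ?_⟩
  rw [hκ.vertexSupport_restrict]
  exact hκ.connected

lemma IsSupportComponent.disjoint_faultSupport {S : C.Fault} {κ κ' : Set C.Vertex}
    (hκ : C.IsSupportComponent S κ) (hκ' : C.IsSupportComponent S κ') (hne : κ ≠ κ') :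
    Disjoint (C.faultSupport (C.restrict S κ)) (C.faultSupport (C.restrict S κ')) := by
  refine Set.disjoint_left.2 ?_
  rintro ⟨k, q⟩ h h'
  obtain ⟨v, hv, rfl, rfl⟩ := restrict_ne_zero h
  obtain ⟨w, hw, h1, h2⟩ := restrict_ne_zero h'
  obtain rfl : w = v := Prod.ext (Fin.castSucc_injective _ h1) h2
  exact hne (hκ.eq_of_mem hκ' hv hw)

/-- Every vertex of the support lies in exactly one component, so exactly one summand is nonzero
there. -/
lemma sum_restrict_eq {S : C.Fault} (hS : S (Fin.last C.depth) = 0) (T : Finset C.Fault)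
    (hT : ∀ F : C.Fault, F ∈ T ↔ ∃ κ, C.IsSupportComponent S κ ∧ F = C.restrict S κ) :
    ∑ F ∈ T, F = S := by
  funext k q
  rw [Finset.sum_apply, Finset.sum_apply]
  by_cases h : S k q = 0
  · rw [h]
    refine Finset.sum_eq_zero fun F hF => ?_
    obtain ⟨κ, -, rfl⟩ := (hT F).1 hF
    exact restrict_eq_zero κ h
  · induction k using Fin.lastCases with
    | last => exact absurd (congrFun hS q) h
    | cast k =>
      obtain ⟨κ, hκ, hmem⟩ := exists_isSupportComponent (F := S) (v := (k, q)) h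
      rw [Finset.sum_eq_single_of_mem (C.restrict S κ) ((hT _).2 ⟨κ, hκ, rfl⟩)]
      · exact C.restrict_of_mem S hmem
      · intro F hF hne
        obtain ⟨κ', hκ', rfl⟩ := (hT F).1 hF
        refine C.restrict_of_notMem S (v := (k, q)) fun hmem' => hne ?_
        rw [hκ.eq_of_mem hκ' hmem hmem']

end CliffordCircuit

end SpacetimeCode

end

theorem mainTheorem7 (n : ℕ) (C : SpacetimeCode.CliffordCircuit n)
    (hlin : C.HasLinearOutcomeCode) (S : C.Fault) (hS : C.IsStabilizer S) :
    (∀ κ : Set C.Vertex, C.IsSupportComponent S κ → C.IsStabilizer (C.restrict S κ)) ∧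
    (∃ T : Finset C.Fault,
      (∀ F : C.Fault, F ∈ T ↔ ∃ κ : Set C.Vertex, C.IsSupportComponent S κ ∧ F = C.restrict S κ) ∧
      (∀ F ∈ T, C.IsConnectedStabilizer F) ∧
      (∀ F ∈ T, ∀ G ∈ T, F ≠ G → Disjoint (C.faultSupport F) (C.faultSupport G)) ∧
      ∑ F ∈ T, F = S) := by
  have hfin : {F : C.Fault | ∃ κ, C.IsSupportComponent S κ ∧ F = C.restrict S κ}.Finite :=
    Set.toFinite _
  have hT : ∀ F : C.Fault, F ∈ hfin.toFinset ↔
      ∃ κ : Set C.Vertex, C.IsSupportComponent S κ ∧ F = C.restrict S κ := by simp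
  refine ⟨fun κ hκ => hS.restrict hlin hκ, hfin.toFinset, hT, ?_, ?_,
    SpacetimeCode.CliffordCircuit.sum_restrict_eq hS.last _ hT⟩
  · intro F hF
    obtain ⟨κ, hκ, rfl⟩ := (hT F).1 hF
    exact hS.isConnectedStabilizer_restrict hlin hκ
  · intro F hF G hG hne
    obtain ⟨κ, hκ, rfl⟩ := (hT F).1 hF
    obtain ⟨κ', hκ', rfl⟩ := (hT G).1 hG
    exact hκ.disjoint_faultSupport hκ' fun h => hne (by rw [h])
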